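/- Let $p\ge 0$ be an integer and let $\mathbf a=(a_1,\dots,a_{p+1})$ and $\mathbf b=(b_1,\dots,b_p)$ be real vectors with positive entries such that $a_1\le 1$ and $$v(t)=\sum_{k=1}^{p}\bigl(t^{a_{k+1}}-t^{b_k}\bigr)\ge 0\qquad\text{for all } t\in[0,1].$$ Write $(\mathbf a)=\prod_{i=1}^{p+1}a_i$, $(\mathbf b)=\prod_{j=1}^{p}b_j$, and let $\mathbf a+1$, $\mathbf b+1$ denote the vectors with all entries increased by $1$. Let ${}_{p+1}F_p(\mathbf a;\mathbf b;\cdot)$ denote the analytic continuation to $\mathbb C\setminus[1,\infty)$ of the sum of the series $$\sum_{n=0}^{\infty}\frac{(a_1)_n\cdots(a_{p+1})_n}{(b_1)_n\cdots(b_p)_n\,n!}\,z^n\qquad(|z|<1),$$ where $(c)_n=c(c+1)\cdots(c+n-1)$. Then, for every complex $z$ with $\operatorname{Re} z<1$, $$\frac{2(\mathbf a)\,|z-2|\,|z|}{(\mathbf b)\,(|z-2|+|z|)^2}\le\bigl|{}_{p+1}F_p(\mathbf a;\mathbf b;z)-1\bigr|\le\frac{2(\mathbf a)\,|z-2|\,|z|}{(\mathbf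 b)\,(|z-2|-|z|)^2},$$ $$\frac{4(|z-2|-|z|)}{(|z-2|+|z|)^3}\le\bigl|{}_{p+1}F_p(\mathbf a+1;\mathbf b+1;z)\bigr|\le\frac{4(|z-2|+|z|)}{(|z-2|-|z|)^3},$$ and, if moreover $z\ne 0$, $$\frac{2(\mathbf b)\,(|z-2|-|z|)}{(\mathbf a)\,|z|\,|z-2|\,(|z-2|+|z|)}\le\left|\frac{{}_{p+1}F_p(\mathbf a+1;\mathbf b+1;z)}{{}_{p+1}F_p(\mathbf a;\mathbf b;z)-1}\right|\le\frac{2(\mathbf b)\,(|z-2|+|z|)}{(\mathbf a)\,|z|\,|z-2|\,(|z-2|-|z|)}.$$ -/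

import Mathlib

open scoped BigOperators

/-- The product of rising factorials `(a)_n = (a_1)_n ⋯ (a_m)_n` of a complex vector `a`. -/
noncomputable def vecPochhammer {m : ℕ} (a : Fin m → ℂ) (n : ℕ) : ℂ :=
  ∏ i, (ascPochhammer ℂ n).eval (a i)

/-- The complex plane cut along the real ray `[1, ∞)`. -/
def cutPlane : Set ℂ := (((↑) : ℝ → ℂ) '' Set.Ici 1)ᶜ

/-- `F` is the analytic continuation to `ℂ \ [1, ∞)` of the hypergeometric series
`∑ (a)_n / ((b)_n n!) z ^ n`, which has unit radius of convergence. -/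
def IsHypergeometricContinuation {p : ℕ} (a : Fin (p + 1) → ℂ) (b : Fin p → ℂ)
    (F : ℂ → ℂ) : Prop :=
  AnalyticOnNhd ℂ F cutPlane ∧
    ∀ z : ℂ, ‖z‖ < 1 →
      HasSum (fun n : ℕ => vecPochhammer a n / (vecPochhammer b n * (n.factorial : ℂ)) * z ^ n)
        (F z)

open Classical in
/-- The generalized hypergeometric function `_{p+1}F_p(a; b; z)` on `ℂ \ [1, ∞)`: the analytic
continuation of the sum of its series. As `ℂ \ [1, ∞)` is connected, the continuation is unique
there, so that the values at points of `ℂ \ [1, ∞)` do not depend on the choice. -/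
noncomputable def genHypergeometric {p : ℕ} (a : Fin (p + 1) → ℂ) (b : Fin p → ℂ) : ℂ → ℂ :=
  if h : ∃ F : ℂ → ℂ, IsHypergeometricContinuation a b F then h.choose else 0

/-- The Müntz polynomial `v_{a,b}(t) = ∑ (t ^ a_k - t ^ b_k)` of two real vectors of equal size. -/
noncomputable def muntzPolynomial {p : ℕ} (a b : Fin p → ℝ) (t : ℝ) : ℝ :=
  ∑ k, (t ^ a k - t ^ b k)

/-!
The bounds are those of the Koebe growth and distortion theorems for `F - 1` as a function of
`w = z / (2 - z)`, which maps the half plane `Re z < 1` onto the unit disc. They are obtained here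
from an integral representation, without univalence.

**The representation.** Since `n! = (1)_n`, the coefficients of `F` are `∏ (a_i)_n / (b_i)_n` with a
further denominator parameter `1`, paired with `a_0 ≤ 1`; the Müntz polynomial of the extended
vectors is still nonnegative on `(0, 1)`. The Euler product writes each ratio `(a)_n / (b)_n` as
`∏_j (n + b + j) (a + j) / ((n + a + j) (b + j))`. Taken over all parameters, its `j`-th factor is
`exp (∫ (t ^ n - 1) d_j(t) dt)` with `d_j(t) = t ^ j v(t) / (t log (1 / t)) ≥ 0`, the moment sequence
of a compound Poisson law carried to `[0, 1]`. Moment sequences of probability measures on `[0, 1]`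
are closed under products and, by compactness, under pointwise limits, so the coefficients of `F`
are the moments of a probability measure `ν` (`exists_hypergeometric_measure`). By the identity
theorem `F(z) = ∫ 1 / (1 - z t) dν` on the cut plane, and the function with parameters increased by
one is `(B / A) ∫ t / (1 - z t) ^ 2 dν` (`genHypergeometric_eq_stieltjesIntegral`,
`hypergeometric_coeff_add_one`).

**The estimates.** Let `D = ‖z - 2‖` and `R = ‖z‖`, so that `R < D`. From
`2 (1 - z t) = (2 - z) + (1 - 2 t) z` one gets `D - R ≤ 2 ‖1 - z t‖ ≤ D + R`. The points `1 - z t` fill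
the segment from `1` to `1 - z`, which lies in a sector of opening less than `π / 2`: the cosine of
the opening is `Re (1 - z) / ‖1 - z‖ ≥ (D ^ 2 - R ^ 2) / (D ^ 2 + R ^ 2)` and the cosine of half of it
is at least `D / (D + R)` (`exists_bisector`, `bisector_cos_bounds`). Hence the integrals of
`t / (1 - z t)` and `t / (1 - z t) ^ 2` have modulus at least these multiples of the integrals of the
moduli, and the six bounds follow (`exists_stieltjes_estimates`, `stieltjes_distortion`).
-/

open Filter Topology MeasureTheory unitInterval

/-! ### Hausdorff moment sequences -/

theorem integrable_unitInterval_of_continuous {E : Type*} [NormedAddCommGroup E] (ν : Measure I)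
    [IsFiniteMeasure ν] {f : I → E} (hf : Continuous f) : Integrable f ν :=
  hf.integrable_of_hasCompactSupport (HasCompactSupport.of_compactSpace f)

/-- `m` is a Hausdorff moment sequence of total mass one: the moments of a probability measure
on `[0, 1]`. -/
def IsHausdorffMoment (m : ℕ → ℝ) : Prop :=
  ∃ ν : ProbabilityMeasure I, ∀ n, ∫ t : I, (t : ℝ) ^ n ∂(ν : Measure I) = m n

namespace IsHausdorffMoment

theorem one : IsHausdorffMoment fun _ => 1 :=
  ⟨⟨Measure.dirac 1, inferInstance⟩, fun n => by simp⟩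

theorem mul {m₁ m₂ : ℕ → ℝ} (h₁ : IsHausdorffMoment m₁) (h₂ : IsHausdorffMoment m₂) :
    IsHausdorffMoment fun n => m₁ n * m₂ n := by
  obtain ⟨ν₁, h₁⟩ := h₁
  obtain ⟨ν₂, h₂⟩ := h₂
  have hmeas : Measurable fun q : I × I => q.1 * q.2 := by fun_prop
  refine ⟨⟨((ν₁ : Measure I).prod (ν₂ : Measure I)).map fun q : I × I => q.1 * q.2,
    Measure.isProbabilityMeasure_map hmeas.aemeasurable⟩, fun n => ?_⟩
  change ∫ t : I, (t : ℝ) ^ n ∂(((ν₁ : Measure I).prod (ν₂ : Measure I)).map _) = _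
  rw [integral_map hmeas.aemeasurable
    (by fun_prop : Continuous fun t : I => (t : ℝ) ^ n).aestronglyMeasurable]
  simp only [Set.Icc.coe_mul, mul_pow]
  rw [integral_prod_mul (fun t : I => (t : ℝ) ^ n) (fun t : I => (t : ℝ) ^ n), h₁, h₂]

theorem prod {ι : Type*} (s : Finset ι) {m : ι → ℕ → ℝ}
    (h : ∀ i ∈ s, IsHausdorffMoment (m i)) : IsHausdorffMoment fun n => ∏ i ∈ s, m i n := by
  classical
  induction s using Finset.induction_on with
  | empty => simpa using one
  | insert i s hi ih =>
    simp only [Finset.prod_insert hi]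
    exact (h i (by simp)).mul (ih fun j hj => h j (by simp [hj]))

/-- Pointwise limits of moment sequences are moment sequences, since the space of probability
measures on `[0, 1]` is compact. -/
theorem of_tendsto {m : ℕ → ℕ → ℝ} {m' : ℕ → ℝ} (h : ∀ᶠ N in atTop, IsHausdorffMoment (m N))
    (hm : ∀ n, Tendsto (fun N => m N n) atTop (𝓝 (m' n))) : IsHausdorffMoment m' := by
  classical
  -- A limit along an ultrafilter needs no metrizability of the space of measures; the value of `ν`
  -- at the finitely many `N` for which `m N` is no moment sequence is irrelevant.
  set ν : ℕ → ProbabilityMeasure I := fun N =>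
    if hN : IsHausdorffMoment (m N) then hN.choose else ⟨Measure.dirac 1, inferInstance⟩ with hν
  have hle : (hyperfilter ℕ : Filter ℕ) ≤ atTop := by
    rw [← Nat.cofinite_eq_atTop]; exact hyperfilter_le_cofinite
  let U : Ultrafilter (ProbabilityMeasure I) := (hyperfilter ℕ).map ν
  have hlim : Tendsto ν (hyperfilter ℕ : Filter ℕ) (𝓝 U.lim) := U.le_nhds_lim
  refine ⟨U.lim, fun n => ?_⟩
  have hlim' := (ProbabilityMeasure.tendsto_iff_forall_integral_tendsto.1 hlim)
    (BoundedContinuousFunction.mkOfCompact ⟨fun t : I => (t : ℝ) ^ n, by fun_prop⟩)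
  refine tendsto_nhds_unique hlim' (((hm n).mono_left hle).congr' ?_)
  filter_upwards [h.filter_mono hle] with N hN
  have hνN : ν N = hN.choose := dif_pos hN
  rw [hνN]
  exact (hN.choose_spec n).symm

/-- The moment sequence of a compound Poisson law, transported to `[0, 1]` by `x ↦ exp (-x)`.
It is the limit of the powers of the moment sequences of `(1 - ‖ρ‖ / N) δ₁ + ρ / N`. -/
theorem exp_integral (ρ : Measure I) [IsFiniteMeasure ρ] :
    IsHausdorffMoment fun n => Real.exp (∫ t : I, ((t : ℝ) ^ n - 1) ∂ρ) := by
  set x : ℕ → ℝ := fun n => ∫ t : I, ((t : ℝ) ^ n - 1) ∂ρ with hx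
  refine of_tendsto (m := fun N n => (1 + x n / N) ^ N) ?_
    fun n => Real.tendsto_one_add_div_pow_exp (x n)
  filter_upwards [eventually_ge_atTop (⌈ρ.real Set.univ⌉₊ + 1)] with N hN
  have hN0 : (0 : ℝ) < N := by exact_mod_cast (by omega : 0 < N)
  have hNρ : ρ.real Set.univ ≤ N :=
    (Nat.le_ceil _).trans (by exact_mod_cast (by omega : ⌈ρ.real Set.univ⌉₊ ≤ N))
  have key : IsHausdorffMoment fun n => 1 + x n / N := by
    have hc : 0 ≤ 1 - ρ.real Set.univ / N := by
      rw [sub_nonneg, div_le_one hN0]; exact hNρ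
    let τ : Measure I := ENNReal.ofReal (1 - ρ.real Set.univ / N) • Measure.dirac 1 +
      ENNReal.ofReal (1 / N) • ρ
    have hτ : IsProbabilityMeasure τ := by
      constructor
      have hu : ρ Set.univ = ENNReal.ofReal (ρ.real Set.univ) := by simp
      simp only [τ, Measure.add_apply, Measure.smul_apply, smul_eq_mul, measure_univ, mul_one]
      rw [hu, ← ENNReal.ofReal_mul (by positivity), ← ENNReal.ofReal_add hc (by positivity),
        ← ENNReal.ofReal_one]
      congr 1; ring
    refine ⟨⟨τ, hτ⟩, fun n => ?_⟩
    change ∫ t : I, (t : ℝ) ^ n ∂τ = _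
    have hcont : Continuous fun t : I => (t : ℝ) ^ n := by fun_prop
    rw [integral_add_measure
      (integrable_unitInterval_of_continuous _ hcont |>.smul_measure (by simp))
      (integrable_unitInterval_of_continuous _ hcont |>.smul_measure (by simp)),
      integral_smul_measure, integral_smul_measure, integral_dirac, ENNReal.toReal_ofReal hc,
      ENNReal.toReal_ofReal (by positivity)]
    simp only [hx]
    rw [integral_sub (integrable_unitInterval_of_continuous _ hcont) (integrable_const _)]
    simp
    ring
  simpa using prod (Finset.range N) (m := fun _ n => 1 + x n / N) fun _ _ => key

/-- The compound Poisson sequence of a measure with density on `(0, 1]`. -/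
theorem exp_intervalIntegral {d : ℝ → ℝ} (hd : IntervalIntegrable d volume 0 1)
    (hd0 : ∀ t ∈ Set.Ioo (0 : ℝ) 1, 0 ≤ d t) :
    IsHausdorffMoment fun n =>
      Real.exp ((∫ t in (0 : ℝ)..1, t ^ n * d t) - ∫ t in (0 : ℝ)..1, d t) := by
  have hd' : IntegrableOn d (Set.Ioo 0 1) := by
    rw [← integrableOn_Ioc_iff_integrableOn_Ioo]
    exact (intervalIntegrable_iff_integrableOn_Ioc_of_le zero_le_one).1 hd
  let κ : Measure ℝ := (volume.restrict (Set.Ioo (0 : ℝ) 1)).withDensity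
    fun t => ENNReal.ofReal (d t)
  have : IsFiniteMeasure κ := isFiniteMeasure_withDensity_ofReal hd'.2
  have hπ : Measurable (Set.projIcc (0 : ℝ) 1 zero_le_one) := continuous_projIcc.measurable
  have key (n : ℕ) : ∫ t : I, (t : ℝ) ^ n ∂(κ.map (Set.projIcc (0 : ℝ) 1 zero_le_one)) =
      ∫ t in (0 : ℝ)..1, t ^ n * d t := by
    rw [integral_map hπ.aemeasurable
      (by fun_prop : Continuous fun t : I => (t : ℝ) ^ n).aestronglyMeasurable,
      integral_withDensity_eq_integral_toReal_smul₀ hd'.1.aemeasurable.ennreal_ofReal (by simp),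
      intervalIntegral.integral_of_le zero_le_one, integral_Ioc_eq_integral_Ioo]
    refine setIntegral_congr_fun measurableSet_Ioo fun t ht => ?_
    simp only [Set.projIcc_of_mem zero_le_one (Set.Ioo_subset_Icc_self ht),
      ENNReal.toReal_ofReal (hd0 t ht), smul_eq_mul]
    ring
  convert exp_integral (κ.map (Set.projIcc (0 : ℝ) 1 zero_le_one)) using 3 with n
  have hcont : Continuous fun t : I => (t : ℝ) ^ n := by fun_prop
  rw [integral_sub (integrable_unitInterval_of_continuous _ hcont) (integrable_const _), key,
    ← integral_congr_ae (ae_of_all _ fun t : I => pow_zero (t : ℝ)), key]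
  simp

end IsHausdorffMoment

/-! ### Compound Poisson factors -/

theorem integrable_pow_mul_rpow_sub_one {a b : ℝ} (ha : 0 < a) (hb : 0 < b) (n : ℕ) :
    Integrable (Function.uncurry fun t y : ℝ => t ^ n * t ^ (y - 1))
      ((volume.restrict (Set.uIoc 0 1)).prod (volume.restrict (Set.uIoc a b))) := by
  have hm : 0 < min a b := lt_min ha hb
  have : IsFiniteMeasure (volume.restrict (Set.uIoc a b)) :=
    isFiniteMeasure_restrict.2 (by rw [Set.uIoc]; exact measure_Ioc_lt_top.ne)
  have hdom : Integrable (fun t : ℝ => t ^ (min a b - 1)) (volume.restrict (Set.uIoc 0 1)) := by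
    rw [← IntegrableOn, ← intervalIntegrable_iff]
    exact intervalIntegral.intervalIntegrable_rpow' (by linarith)
  refine (hdom.comp_fst (volume.restrict (Set.uIoc a b))).mono' ?_ ?_
  · exact Measurable.aestronglyMeasurable (by unfold Function.uncurry; fun_prop)
  · rw [Measure.prod_restrict]
    refine (ae_restrict_iff' (measurableSet_uIoc.prod measurableSet_uIoc)).2 (ae_of_all _ ?_)
    rintro ⟨t, y⟩ ⟨ht, hy⟩
    rw [Set.uIoc_of_le zero_le_one] at ht
    simp only [Set.uIoc, Set.mem_Ioc] at ht hy
    have h1 : t ^ (y - 1) ≤ t ^ (min a b - 1) :=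
      Real.rpow_le_rpow_of_exponent_ge ht.1 ht.2 (by linarith [hy.1])
    have h2 : t ^ n ≤ 1 := pow_le_one₀ ht.1.le ht.2
    have h3 : 0 ≤ t ^ (y - 1) := Real.rpow_nonneg ht.1.le _
    have h4 : 0 ≤ t ^ n := pow_nonneg ht.1.le n
    simp only [Function.uncurry, Real.norm_eq_abs, abs_of_nonneg (mul_nonneg h4 h3)]
    nlinarith

theorem intervalIntegrable_pow_mul_integral_rpow {a b : ℝ} (ha : 0 < a) (hb : 0 < b) (n : ℕ) :
    IntervalIntegrable (fun t : ℝ => t ^ n * ∫ y in a..b, t ^ (y - 1)) volume 0 1 := by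
  rw [intervalIntegrable_iff]
  simp_rw [← intervalIntegral.integral_const_mul]
  simp only [intervalIntegral.intervalIntegral_eq_integral_uIoc]
  exact (integrable_pow_mul_rpow_sub_one ha hb n).integral_prod_left.smul
    (if a ≤ b then 1 else -1 : ℝ)

/-- Fubini's theorem reduces the integral to that of `1 / (n + y)` over `[a, b]`. -/
theorem integral_pow_mul_integral_rpow {a b : ℝ} (ha : 0 < a) (hb : 0 < b) (n : ℕ) :
    ∫ t in (0 : ℝ)..1, t ^ n * ∫ y in a..b, t ^ (y - 1) = Real.log ((n + b) / (n + a)) := by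
  simp_rw [← intervalIntegral.integral_const_mul]
  rw [intervalIntegral_intervalIntegral_swap (by
    rw [IntegrableOn, Measure.volume_eq_prod, ← Measure.prod_restrict]
    exact integrable_pow_mul_rpow_sub_one ha hb n)]
  have hpos : ∀ y ∈ Set.uIcc a b, 0 < y := fun y hy =>
    (lt_min ha hb).trans_le (Set.mem_Icc.1 hy).1
  have inner : ∀ y ∈ Set.uIcc a b, ∫ t in (0 : ℝ)..1, t ^ n * t ^ (y - 1) = (n + y)⁻¹ := by
    intro y hy
    have hy0 := hpos y hy
    have hn : (0 : ℝ) ≤ n := n.cast_nonneg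
    calc ∫ t in (0 : ℝ)..1, t ^ n * t ^ (y - 1) = ∫ t in (0 : ℝ)..1, t ^ (n + y - 1) := by
          refine intervalIntegral.integral_congr_ae (ae_of_all _ fun t ht => ?_)
          rw [Set.uIoc_of_le zero_le_one] at ht
          rw [← Real.rpow_natCast, ← Real.rpow_add ht.1]
          congr 1; ring
      _ = (n + y)⁻¹ := by
          rw [integral_rpow (Or.inl (by linarith)), Real.one_rpow, Real.zero_rpow (by linarith)]
          simp
  rw [intervalIntegral.integral_congr inner,
    intervalIntegral.integral_comp_add_left (fun x : ℝ => x⁻¹) (n : ℝ),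
    integral_inv_of_pos (by positivity) (by positivity)]

theorem integral_rpow_sub_one_eq {a b t : ℝ} (ht : t ∈ Set.Ioo (0 : ℝ) 1) :
    ∫ y in a..b, t ^ (y - 1) = (t ^ a - t ^ b) / (t * -Real.log t) := by
  have hlog : Real.log t ≠ 0 := (Real.log_neg ht.1 ht.2).ne
  have hd : ∀ y ∈ Set.uIcc a b,
      HasDerivAt (fun y : ℝ => t ^ (y - 1) / Real.log t) (t ^ (y - 1)) y := by
    intro y _
    have h := ((hasDerivAt_id y).sub_const 1).const_rpow ht.1
    have h' := h.div_const (Real.log t)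
    refine h'.congr_deriv ?_
    simp only [id]
    field_simp
  rw [intervalIntegral.integral_eq_sub_of_hasDerivAt hd
    (Continuous.intervalIntegrable (Continuous.rpow (by fun_prop) (by fun_prop)
      fun _ => Or.inl ht.1.ne') _ _),
    Real.rpow_sub_one ht.1.ne', Real.rpow_sub_one ht.1.ne']
  have := ht.1.ne'
  field_simp
  ring

namespace IsHausdorffMoment

/-- The sequence is `exp (∫ (t ^ n - 1) d(t) dt)` with the density `d(t) = v(t) / (t log (1 / t))`,
where `v` is the Müntz polynomial of `a` and `b`. The density is written as a sum of integrals
`∫ t ^ (y - 1) dy` over `[a i, b i]`, which makes its integrability and its moments accessible. -/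
theorem prod_add_div_add {q : ℕ} {a b : Fin q → ℝ} (ha : ∀ i, 0 < a i) (hb : ∀ i, 0 < b i)
    (hv : ∀ t ∈ Set.Ioo (0 : ℝ) 1, 0 ≤ muntzPolynomial a b t) :
    IsHausdorffMoment fun n => ∏ i, ((n + b i) / (n + a i) * (a i / b i)) := by
  have hint (i : Fin q) (n : ℕ) := intervalIntegrable_pow_mul_integral_rpow (ha i) (hb i) n
  have h := exp_intervalIntegral (d := fun t => ∑ i, ∫ y in a i..b i, t ^ (y - 1))
    (by
      have hd : (fun t => ∑ i, ∫ y in a i..b i, t ^ (y - 1)) =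
          ∑ i, fun t : ℝ => t ^ 0 * ∫ y in a i..b i, t ^ (y - 1) := by
        ext t
        simp
      rw [hd]
      exact IntervalIntegrable.sum Finset.univ fun i _ => hint i 0)
    (fun t ht => by
      simp only [integral_rpow_sub_one_eq ht, ← Finset.sum_div]
      exact div_nonneg (hv t ht)
        (mul_nonneg ht.1.le (neg_nonneg.2 (Real.log_neg ht.1 ht.2).le)))
  convert h using 2 with n
  have hsum (n : ℕ) : ∫ t in (0 : ℝ)..1, t ^ n * ∑ i, ∫ y in a i..b i, t ^ (y - 1) =
      ∑ i, Real.log ((n + b i) / (n + a i)) := by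
    simp only [Finset.mul_sum]
    rw [intervalIntegral.integral_finsetSum fun i _ => hint i n]
    exact Finset.sum_congr rfl fun i _ => integral_pow_mul_integral_rpow (ha i) (hb i) n
  have h0 := hsum 0
  simp only [pow_zero, one_mul, Nat.cast_zero, zero_add] at h0
  rw [hsum, h0, ← Finset.sum_sub_distrib, Real.exp_sum]
  refine Finset.prod_congr rfl fun i _ => ?_
  have := ha i
  have := hb i
  rw [Real.exp_sub, Real.exp_log (by positivity), Real.exp_log (by positivity)]
  field_simp

end IsHausdorffMoment

/-! ### Ratios of rising factorials as moments -/

theorem ascPochhammer_eval_ofReal (n : ℕ) (x : ℝ) :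
    (ascPochhammer ℂ n).eval (x : ℂ) = (((ascPochhammer ℝ n).eval x : ℝ) : ℂ) := by
  have := Polynomial.eval_map_apply (f := Complex.ofRealHom) (p := ascPochhammer ℝ n) (x := x)
  rw [ascPochhammer_map] at this
  simpa using this

theorem ascPochhammer_eval_succ_left {R : Type*} [CommSemiring R] (n : ℕ) (x : R) :
    (ascPochhammer R (n + 1)).eval x = x * (ascPochhammer R n).eval (x + 1) := by
  simp [ascPochhammer_succ_left, Polynomial.eval_comp]

/-- The partial products of the Euler product of `(a)_n / (b)_n`. -/
theorem prod_range_add_div_add {a b : ℝ} (ha : 0 < a) (hb : 0 < b) (n N : ℕ) :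
    ∏ j ∈ Finset.range N, ((n + (b + j)) / (n + (a + j)) * ((a + j) / (b + j))) =
      (ascPochhammer ℝ n).eval a / (ascPochhammer ℝ n).eval b *
        ((ascPochhammer ℝ n).eval (b + N) / (ascPochhammer ℝ n).eval (a + N)) := by
  induction N with
  | zero =>
    have := (ascPochhammer_pos n a ha).ne'
    have := (ascPochhammer_pos n b hb).ne'
    simp
    field_simp
  | succ N ih =>
    have shift (x : ℝ) (hx : 0 < x) : (ascPochhammer ℝ n).eval (x + (N + 1)) =
        (ascPochhammer ℝ n).eval (x + N) * (n + (x + N)) / (x + N) := by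
      have h := ascPochhammer_succ_eval n (x + N)
      rw [ascPochhammer_eval_succ_left] at h
      have : x + N ≠ 0 := by positivity
      rw [← add_assoc, eq_div_iff this]
      linarith
    rw [Finset.prod_range_succ, ih]
    push_cast
    rw [shift a ha, shift b hb]
    have := (ascPochhammer_pos n a ha).ne'
    have := (ascPochhammer_pos n b hb).ne'
    have := (ascPochhammer_pos n (a + N) (by positivity)).ne'
    have := (ascPochhammer_pos n (b + N) (by positivity)).ne'
    field_simp

theorem tendsto_ascPochhammer_eval_div (a b : ℝ) (n : ℕ) :
    Tendsto (fun N : ℕ => (ascPochhammer ℝ n).eval (b + N) / (ascPochhammer ℝ n).eval (a + N))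
      atTop (𝓝 1) := by
  induction n with
  | zero => simp
  | succ n ih =>
    simp only [ascPochhammer_succ_eval, mul_div_mul_comm]
    have h : Tendsto (fun N : ℕ => (b + N + n) / (a + N + n)) atTop (𝓝 1) := by
      have hden : Tendsto (fun N : ℕ => a + N + n) atTop atTop :=
        tendsto_atTop_add_const_right _ _
          (tendsto_atTop_add_const_left _ _ tendsto_natCast_atTop_atTop)
      have h1 : Tendsto (fun N : ℕ => 1 + (b - a) / (a + N + n)) atTop (𝓝 (1 + 0)) :=
        (tendsto_const_nhds.div_atTop hden).const_add 1
      rw [add_zero] at h1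
      refine h1.congr' ?_
      filter_upwards [hden.eventually_gt_atTop 0] with N hN
      field_simp
      ring
    simpa using ih.mul h

theorem muntzPolynomial_add_const {q : ℕ} (a b : Fin q → ℝ) (c : ℝ) {t : ℝ} (ht : 0 < t) :
    muntzPolynomial (fun i => a i + c) (fun i => b i + c) t = t ^ c * muntzPolynomial a b t := by
  simp only [muntzPolynomial, Finset.mul_sum]
  refine Finset.sum_congr rfl fun i _ => ?_
  rw [Real.rpow_add ht, Real.rpow_add ht]
  ring

/-- A ratio of products of rising factorials is a Hausdorff moment sequence as soon as the Müntz
polynomial of its parameters is nonnegative: every partial product of its Euler product is. -/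
theorem isHausdorffMoment_ascPochhammer {q : ℕ} {a b : Fin q → ℝ} (ha : ∀ i, 0 < a i)
    (hb : ∀ i, 0 < b i) (hv : ∀ t ∈ Set.Ioo (0 : ℝ) 1, 0 ≤ muntzPolynomial a b t) :
    IsHausdorffMoment fun n =>
      ∏ i, ((ascPochhammer ℝ n).eval (a i) / (ascPochhammer ℝ n).eval (b i)) := by
  refine IsHausdorffMoment.of_tendsto (m := fun N n => ∏ j ∈ Finset.range N,
    ∏ i, ((n + (b i + j)) / (n + (a i + j)) * ((a i + j) / (b i + j))))
    (Eventually.of_forall fun N => IsHausdorffMoment.prod _ fun j _ =>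
      IsHausdorffMoment.prod_add_div_add (a := fun i => a i + j) (b := fun i => b i + j)
        (fun i => by have := ha i; positivity) (fun i => by have := hb i; positivity)
        fun t ht => ?_) fun n => ?_
  · rw [muntzPolynomial_add_const a b j ht.1]
    exact mul_nonneg (Real.rpow_nonneg ht.1.le _) (hv t ht)
  · simp only [Finset.prod_comm (s := Finset.range _), prod_range_add_div_add (ha _) (hb _)]
    refine tendsto_finsetProd _ fun i _ => ?_
    simpa using (tendsto_ascPochhammer_eval_div (a i) (b i) n).const_mul
      ((ascPochhammer ℝ n).eval (a i) / (ascPochhammer ℝ n).eval (b i))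

/-- The coefficients of `_{p+1}F_p(a; b; z)` are moments of a probability measure on `[0, 1]`. As
`n! = (1)_n`, the factorial is one more denominator parameter, paired with `a 0 ≤ 1`. -/
theorem exists_hypergeometric_measure {p : ℕ} {a : Fin (p + 1) → ℝ} {b : Fin p → ℝ}
    (ha : ∀ i, 0 < a i) (hb : ∀ j, 0 < b j) (ha1 : a 0 ≤ 1)
    (hv : ∀ t ∈ Set.Icc (0 : ℝ) 1, 0 ≤ muntzPolynomial (Fin.tail a) b t) :
    ∃ ν : ProbabilityMeasure I, ∀ n, ((∫ t : I, (t : ℝ) ^ n ∂(ν : Measure I) : ℝ) : ℂ) =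
      vecPochhammer (fun i => (a i : ℂ)) n /
        (vecPochhammer (fun j => (b j : ℂ)) n * (n.factorial : ℂ)) := by
  obtain ⟨ν, h⟩ := isHausdorffMoment_ascPochhammer (a := a) (b := Fin.cons 1 b) ha
    (fun i => by refine Fin.cases ?_ (fun j => ?_) i <;> simp [hb]) (fun t ht => by
      have h1 : t ^ (1 : ℝ) ≤ t ^ a 0 := Real.rpow_le_rpow_of_exponent_ge ht.1 ht.2.le ha1
      have h2 := hv t ⟨ht.1.le, ht.2.le⟩
      simp only [muntzPolynomial, Fin.tail] at h2 ⊢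
      rw [Fin.sum_univ_succ]
      simp only [Fin.cons_zero, Fin.cons_succ]
      linarith)
  refine ⟨ν, fun n => ?_⟩
  rw [h n]
  beta_reduce
  rw [Finset.prod_div_distrib, Fin.prod_univ_succ (fun i => (ascPochhammer ℝ n).eval
    ((Fin.cons 1 b : Fin (p + 1) → ℝ) i))]
  simp only [Fin.cons_zero, Fin.cons_succ, ascPochhammer_eval_one, vecPochhammer]
  push_cast
  simp only [← ascPochhammer_eval_ofReal]
  rw [mul_comm (n.factorial : ℂ)]

/-! ### Stieltjes integrals on the cut plane -/

theorem one_sub_mul_ne_zero_of_mem_cutPlane {z : ℂ} (hz : z ∈ cutPlane) (t : I) :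
    1 - z * (t : ℝ) ≠ 0 := by
  intro h
  have h1 : z * (t : ℝ) = 1 := (sub_eq_zero.1 h).symm
  have ht : ((t : ℝ) : ℂ) ≠ 0 := fun h0 => by simp [h0] at h1
  have ht0 : 0 < (t : ℝ) := lt_of_le_of_ne t.2.1 fun h0 => ht (by simp [← h0])
  refine hz ⟨(t : ℝ)⁻¹, (one_le_inv₀ ht0).2 t.2.2, ?_⟩
  rw [Complex.ofReal_inv, eq_inv_of_mul_eq_one_left h1]

theorem isOpen_cutPlane : IsOpen cutPlane :=
  (Complex.isometry_ofReal.isClosedEmbedding.isClosedMap _ isClosed_Ici).isOpen_compl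

theorem mem_cutPlane_of_re_lt_one {z : ℂ} (hz : z.re < 1) : z ∈ cutPlane := by
  rintro ⟨x, hx, rfl⟩
  exact absurd hx (not_le.2 (by simpa using hz))

theorem mem_cutPlane_of_norm_lt_one {z : ℂ} (hz : ‖z‖ < 1) : z ∈ cutPlane :=
  mem_cutPlane_of_re_lt_one ((Complex.re_le_norm z).trans_lt hz)

theorem isPreconnected_cutPlane : IsPreconnected cutPlane := by
  have h : StarConvex ℝ 0 cutPlane := by
    rw [starConvex_zero_iff]
    rintro z hz s hs0 hs1 ⟨x, hx, hxz⟩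
    refine one_sub_mul_ne_zero_of_mem_cutPlane hz ⟨s / x, ?_, ?_⟩ ?_
    · exact div_nonneg hs0 (zero_le_one.trans hx)
    · exact (div_le_one (zero_lt_one.trans_le hx)).2 (hs1.trans hx)
    · have hx0 : (x : ℂ) ≠ 0 := by exact_mod_cast (zero_lt_one.trans_le hx).ne'
      rw [Complex.real_smul] at hxz
      push_cast
      rw [sub_eq_zero, mul_div_assoc', mul_comm, ← hxz, div_self hx0]
  exact (h.isPathConnected (mem_cutPlane_of_re_lt_one (by simp))).isConnected.isPreconnected

/-- Differentiation under the integral sign over `[0, 1]`. -/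
theorem differentiableOn_integral_unitInterval (ν : Measure I) [IsFiniteMeasure ν]
    {K K' : ℂ → I → ℂ} {U : Set ℂ} (hU : IsOpen U)
    (hK : ∀ z ∈ U, Continuous (K z)) (hd : ∀ z ∈ U, ∀ t, HasDerivAt (fun z => K z t) (K' z t) z)
    (hK' : ContinuousOn (Function.uncurry K') (U ×ˢ Set.univ)) :
    DifferentiableOn ℂ (fun z => ∫ t, K z t ∂ν) U := by
  intro z₀ hz₀
  obtain ⟨ε, hε, hball⟩ := Metric.nhds_basis_closedBall.mem_iff.1 (hU.mem_nhds hz₀)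
  obtain ⟨C, hC⟩ := ((isCompact_closedBall z₀ ε).prod isCompact_univ).exists_bound_of_continuousOn
    (hK'.mono (Set.prod_mono hball subset_rfl))
  have h := hasDerivAt_integral_of_dominated_loc_of_deriv_le (μ := ν) (F := K) (F' := K')
    (bound := fun _ => C) (Metric.closedBall_mem_nhds z₀ hε) ?_ ?_ ?_ ?_ (integrable_const C) ?_
  · exact h.2.differentiableAt.differentiableWithinAt
  · filter_upwards [hU.mem_nhds hz₀] with z hz
    exact (hK z hz).aestronglyMeasurable
  · exact integrable_unitInterval_of_continuous ν (hK z₀ hz₀)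
  · exact Continuous.aestronglyMeasurable (hK'.comp_continuous (f := fun t => (z₀, t))
      (by fun_prop) fun t => ⟨hz₀, trivial⟩)
  · exact ae_of_all _ fun t z hz => hC (z, t) ⟨hz, trivial⟩
  · exact ae_of_all _ fun t z hz => hd z (hball hz) t

/-- The integral `∫ t ^ k / (1 - z t) ^ (k + 1) dν(t)`, which is `1 / k!` times the `k`-th derivative
of the Stieltjes transform `∫ 1 / (1 - z t) dν(t)`. -/
noncomputable def stieltjesIntegral (ν : Measure I) (k : ℕ) (z : ℂ) : ℂ :=
  ∫ t : I, ((t : ℝ) : ℂ) ^ k / (1 - z * (t : ℝ)) ^ (k + 1) ∂ν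

theorem continuous_stieltjes_kernel {z : ℂ} (hz : z ∈ cutPlane) (k : ℕ) :
    Continuous fun t : I => ((t : ℝ) : ℂ) ^ k / (1 - z * (t : ℝ)) ^ (k + 1) :=
  Continuous.div (by fun_prop) (by fun_prop) fun t =>
    pow_ne_zero _ (one_sub_mul_ne_zero_of_mem_cutPlane hz t)

theorem analyticOnNhd_stieltjesIntegral (ν : Measure I) [IsFiniteMeasure ν] (k : ℕ) :
    AnalyticOnNhd ℂ (stieltjesIntegral ν k) cutPlane := by
  refine DifferentiableOn.analyticOnNhd (differentiableOn_integral_unitInterval ν isOpen_cutPlane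
    (K' := fun z t => (k + 1) * ((t : ℝ) : ℂ) ^ (k + 1) / (1 - z * (t : ℝ)) ^ (k + 2))
    (fun z hz => continuous_stieltjes_kernel hz k) (fun z hz t => ?_) ?_) isOpen_cutPlane
  · have h0 := one_sub_mul_ne_zero_of_mem_cutPlane hz t
    have h := ((((hasDerivAt_id z).mul_const ((t : ℝ) : ℂ)).const_sub 1).pow (k + 1)).inv
      (pow_ne_zero _ h0) |>.const_mul (((t : ℝ) : ℂ) ^ k)
    refine (h.congr_deriv ?_).congr_of_eventuallyEq
      (Eventually.of_forall fun w => div_eq_mul_inv _ _)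
    simp
    field_simp
    ring
  · refine ContinuousOn.div (by fun_prop) (by fun_prop) ?_
    rintro ⟨z, t⟩ ⟨hz, -⟩
    exact pow_ne_zero _ (one_sub_mul_ne_zero_of_mem_cutPlane hz t)

theorem hasSum_stieltjesIntegral (ν : Measure I) [IsFiniteMeasure ν] (k : ℕ) {z : ℂ}
    (hz : ‖z‖ < 1) :
    HasSum (fun n : ℕ => ((n + k).choose k : ℂ) * ((∫ t : I, (t : ℝ) ^ (n + k) ∂ν : ℝ) : ℂ) * z ^ n)
      (stieltjesIntegral ν k z) := by
  have hs : Summable fun n : ℕ => ((n + k).choose k : ℝ) * ‖z‖ ^ n :=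
    (hasSum_choose_mul_geometric_of_norm_lt_one k (by simpa using hz)).summable
  have h := hasSum_integral_of_dominated_convergence (μ := ν)
    (F := fun (n : ℕ) (t : I) => ((n + k).choose k : ℂ) * ((t : ℝ) : ℂ) ^ (n + k) * z ^ n)
    (f := fun t : I => ((t : ℝ) : ℂ) ^ k / (1 - z * (t : ℝ)) ^ (k + 1))
    (fun n _ => ((n + k).choose k : ℝ) * ‖z‖ ^ n)
    (fun n => Continuous.aestronglyMeasurable (by fun_prop))
    (fun n => ae_of_all _ fun t => ?_) (ae_of_all _ fun t => hs) (integrable_const _)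
    (ae_of_all _ fun t => ?_)
  · refine h.congr_fun fun n => ?_
    rw [integral_mul_const, integral_const_mul, ← integral_complex_ofReal]
    simp only [Complex.ofReal_pow]
  · have h1 : ‖((t : ℝ) : ℂ)‖ ≤ 1 := by
      rw [Complex.norm_real, Real.norm_eq_abs, abs_of_nonneg t.2.1]; exact t.2.2
    simp only [norm_mul, norm_pow, Complex.norm_natCast]
    have := pow_le_one₀ (n := n + k) (norm_nonneg _) h1
    gcongr
    exact mul_le_of_le_one_right (by positivity) this
  · have h1 : ‖z * ((t : ℝ) : ℂ)‖ < 1 := by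
      rw [norm_mul, Complex.norm_real, Real.norm_eq_abs, abs_of_nonneg t.2.1]
      exact (mul_le_of_le_one_right (norm_nonneg _) t.2.2).trans_lt hz
    have h2 := (hasSum_choose_mul_geometric_of_norm_lt_one k h1).mul_left (((t : ℝ) : ℂ) ^ k)
    rw [mul_one_div] at h2
    refine h2.congr_fun fun n => ?_
    rw [mul_pow]
    ring

/-- A hypergeometric series whose coefficients are `c * C(n + k, k)` times the moments of `ν`
continues to the cut plane as a multiple of a Stieltjes integral. -/
theorem genHypergeometric_eq_stieltjesIntegral {p : ℕ} {a : Fin (p + 1) → ℂ} {b : Fin p → ℂ}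
    (ν : Measure I) [IsFiniteMeasure ν] (k : ℕ) (c : ℂ)
    (h : ∀ n : ℕ, vecPochhammer a n / (vecPochhammer b n * (n.factorial : ℂ)) =
      c * (((n + k).choose k : ℂ) * ((∫ t : I, (t : ℝ) ^ (n + k) ∂ν : ℝ) : ℂ)))
    {z : ℂ} (hz : z ∈ cutPlane) :
    genHypergeometric a b z = c * stieltjesIntegral ν k z := by
  have hcont : IsHypergeometricContinuation a b fun z => c * stieltjesIntegral ν k z := by
    refine ⟨analyticOnNhd_const.mul (analyticOnNhd_stieltjesIntegral ν k), fun z hz => ?_⟩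
    simp only [h, mul_assoc]
    simpa only [mul_assoc] using (hasSum_stieltjesIntegral ν k hz).mul_left c
  have hex : ∃ F : ℂ → ℂ, IsHypergeometricContinuation a b F := ⟨_, hcont⟩
  have hchoose : IsHypergeometricContinuation a b (genHypergeometric a b) := by
    rw [genHypergeometric, dif_pos hex]
    exact hex.choose_spec
  refine hchoose.1.eqOn_of_preconnected_of_eventuallyEq hcont.1 isPreconnected_cutPlane
    (mem_cutPlane_of_norm_lt_one (z := 0) (by simp)) ?_ hz
  filter_upwards [Metric.ball_mem_nhds (0 : ℂ) one_pos] with w hw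
  rw [mem_ball_zero_iff] at hw
  exact (hchoose.2 w hw).unique (hcont.2 w hw)

/-! ### Contiguous parameters -/

theorem vecPochhammer_succ {m : ℕ} (a : Fin m → ℂ) (n : ℕ) :
    vecPochhammer a (n + 1) = (∏ i, a i) * vecPochhammer (fun i => a i + 1) n := by
  simp only [vecPochhammer, ascPochhammer_eval_succ_left, Finset.prod_mul_distrib]

/-- Raising all parameters by one shifts the coefficients: the series with parameters `a + 1`, `b + 1`
is `B / A` times the derivative of the series with parameters `a`, `b`. -/
theorem hypergeometric_coeff_add_one {p : ℕ} {a : Fin (p + 1) → ℝ} {b : Fin p → ℝ}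
    (ha : ∀ i, 0 < a i) (hb : ∀ j, 0 < b j) (n : ℕ) :
    vecPochhammer (fun i => (a i : ℂ) + 1) n /
        (vecPochhammer (fun j => (b j : ℂ) + 1) n * (n.factorial : ℂ)) =
      (∏ j, (b j : ℂ)) / (∏ i, (a i : ℂ)) * ((n + 1 : ℂ) *
        (vecPochhammer (fun i => (a i : ℂ)) (n + 1) /
          (vecPochhammer (fun j => (b j : ℂ)) (n + 1) * ((n + 1).factorial : ℂ)))) := by
  have hA : ∏ i, (a i : ℂ) ≠ 0 :=
    Finset.prod_ne_zero_iff.2 fun i _ => Complex.ofReal_ne_zero.2 (ha i).ne'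
  have hB : ∏ j, (b j : ℂ) ≠ 0 :=
    Finset.prod_ne_zero_iff.2 fun j _ => Complex.ofReal_ne_zero.2 (hb j).ne'
  have hn : (n + 1 : ℂ) ≠ 0 := by exact_mod_cast n.succ_ne_zero
  have hb1 : vecPochhammer (fun j => (b j : ℂ) + 1) n ≠ 0 :=
    Finset.prod_ne_zero_iff.2 fun j _ => by
      have := ascPochhammer_eval_ofReal n (b j + 1)
      push_cast at this
      rw [this]
      exact Complex.ofReal_ne_zero.2 (ascPochhammer_pos n _ (by linarith [hb j])).ne'
  have hfac : (n.factorial : ℂ) ≠ 0 := by exact_mod_cast n.factorial_ne_zero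
  rw [vecPochhammer_succ, vecPochhammer_succ, Nat.factorial_succ]
  push_cast
  field_simp

/-! ### Sectors and distortion for Stieltjes integrals -/

/-- If the values of `f` lie in the sector of opening `2 arccos c` about the direction `conj u`, then
integration loses at most a factor `c` of the modulus. -/
theorem mul_integral_norm_le_norm_integral (ν : Measure I) [IsFiniteMeasure ν] {f : I → ℂ}
    (hf : Continuous f) {u : ℂ} (hu : ‖u‖ = 1) {c : ℝ} (h : ∀ t, c * ‖f t‖ ≤ (u * f t).re) :
    c * ∫ t, ‖f t‖ ∂ν ≤ ‖∫ t, f t ∂ν‖ := by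
  have hint : Integrable (fun t => u * f t) ν :=
    integrable_unitInterval_of_continuous ν (by fun_prop)
  calc c * ∫ t, ‖f t‖ ∂ν = ∫ t, c * ‖f t‖ ∂ν := (integral_const_mul _ _).symm
    _ ≤ ∫ t, (u * f t).re ∂ν := integral_mono
        (integrable_unitInterval_of_continuous ν (by fun_prop)) hint.re h
    _ = (u * ∫ t, f t ∂ν).re := by
        rw [← integral_const_mul]; exact integral_re hint
    _ ≤ ‖u * ∫ t, f t ∂ν‖ := Complex.re_le_norm _
    _ = ‖∫ t, f t ∂ν‖ := by rw [norm_mul, hu, one_mul]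

/-- The segment from `1` to `q` lies in the sector between its endpoints; `u` is the conjugate
direction of the bisector and `h` the cosine of half the opening. -/
theorem exists_bisector {q : ℂ} (hq : 0 < q.re) :
    ∃ u : ℂ, ‖u‖ = 1 ∧ ∃ h : ℝ, 0 ≤ h ∧ 2 * h ^ 2 - 1 = q.re / ‖q‖ ∧
      ∀ t ∈ Set.Icc (0 : ℝ) 1, h * ‖(1 - t : ℂ) + t * q‖ ≤ (u * ((1 - t : ℂ) + t * q)).re := by
  have hq0 : 0 < ‖q‖ := hq.trans_le (Complex.re_le_norm q)
  set c : ℝ := q.re / ‖q‖ with hc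
  have hc0 : 0 < c := div_pos hq hq0
  set h : ℝ := √((1 + c) / 2) with hh
  have hh2 : h ^ 2 = (1 + c) / 2 := Real.sq_sqrt (by positivity)
  have hh0 : 0 < h := Real.sqrt_pos.2 (by positivity)
  have hnq : ‖q‖ ^ 2 = q.re ^ 2 + q.im ^ 2 := by
    rw [← Complex.normSq_eq_norm_sq, Complex.normSq_apply]; ring
  have hre : q.re = c * ‖q‖ := by rw [hc]; field_simp
  have him : (q.im / ‖q‖) ^ 2 = 1 - c ^ 2 := by
    rw [hc]; field_simp; linarith
  -- `u` is the conjugate of `(1 + q / ‖q‖) / (2 h)`, where `‖1 + q / ‖q‖‖ = 2 h`.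
  refine ⟨⟨(1 + c) / (2 * h), -(q.im / ‖q‖) / (2 * h)⟩, ?_, h, hh0.le, by rw [hh2]; ring,
    fun t ht => ?_⟩
  · rw [← sq_eq_sq₀ (norm_nonneg _) zero_le_one, ← Complex.normSq_eq_norm_sq,
      Complex.normSq_apply]
    have : (1 + c) / (2 * h) * ((1 + c) / (2 * h)) +
        -(q.im / ‖q‖) / (2 * h) * (-(q.im / ‖q‖) / (2 * h)) =
        ((1 + c) ^ 2 + (q.im / ‖q‖) ^ 2) / (4 * h ^ 2) := by ring
    simp only
    rw [this, him, hh2]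
    field_simp
    ring
  · have hre_eq : ((⟨(1 + c) / (2 * h), -(q.im / ‖q‖) / (2 * h)⟩ : ℂ) *
        ((1 - t : ℂ) + t * q)).re = h * ((1 - t) + t * ‖q‖) := by
      have him' : q.im * (q.im / ‖q‖) = (1 - c ^ 2) * ‖q‖ := by
        rw [← him]; field_simp
      have e : ((⟨(1 + c) / (2 * h), -(q.im / ‖q‖) / (2 * h)⟩ : ℂ) *
          ((1 - t : ℂ) + t * q)).re =
          ((1 + c) * ((1 - t) + t * q.re) + t * (q.im * (q.im / ‖q‖))) / (2 * h) := by
        simp [Complex.mul_re]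
        ring
      rw [e, him', hre, div_eq_iff (by positivity)]
      linear_combination (-2) * ((1 - t) + t * ‖q‖) * hh2
    rw [hre_eq]
    refine mul_le_mul_of_nonneg_left ((norm_add_le _ _).trans (le_of_eq ?_)) hh0.le
    rw [norm_mul, Complex.norm_real, Real.norm_of_nonneg ht.1, ← Complex.ofReal_one,
      ← Complex.ofReal_sub, Complex.norm_real, Real.norm_of_nonneg (by linarith [ht.2])]

theorem mul_norm_inv_le_re {u s : ℂ} {h : ℝ} (hs : h * ‖s‖ ≤ (u * s).re) :
    h * ‖s⁻¹‖ ≤ ((starRingEnd ℂ u) * s⁻¹).re := by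
  rcases eq_or_ne s 0 with rfl | hs0
  · simp
  have hn : 0 < ‖s‖ := norm_pos_iff.2 hs0
  have e : (starRingEnd ℂ u) * s⁻¹ = starRingEnd ℂ (u * s) * ((‖s‖ ^ 2)⁻¹ : ℝ) := by
    rw [Complex.inv_def, Complex.normSq_eq_norm_sq, map_mul, mul_assoc]
  rw [e, Complex.re_mul_ofReal, Complex.conj_re, norm_inv]
  calc h * ‖s‖⁻¹ = h * ‖s‖ * (‖s‖ ^ 2)⁻¹ := by field_simp
    _ ≤ _ := by gcongr

theorem mul_norm_sq_le_re_sq {u s : ℂ} (hu : ‖u‖ = 1) {h : ℝ} (h0 : 0 ≤ h)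
    (hs : h * ‖s‖ ≤ (u * s).re) : (2 * h ^ 2 - 1) * ‖s ^ 2‖ ≤ (u ^ 2 * s ^ 2).re := by
  have h1 : ‖s‖ ^ 2 = (u * s).re ^ 2 + (u * s).im ^ 2 := by
    have : ‖s‖ = ‖u * s‖ := by rw [norm_mul, hu, one_mul]
    rw [this, ← Complex.normSq_eq_norm_sq, Complex.normSq_apply]; ring
  have h2 : (h * ‖s‖) ^ 2 ≤ (u * s).re ^ 2 := by gcongr
  rw [← mul_pow, norm_pow, sq (u * s), Complex.mul_re]
  nlinarith

theorem norm_lt_norm_sub_two {z : ℂ} (hz : z.re < 1) : ‖z‖ < ‖z - 2‖ := by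
  rw [← sq_lt_sq₀ (norm_nonneg _) (norm_nonneg _), ← Complex.normSq_eq_norm_sq,
    ← Complex.normSq_eq_norm_sq, Complex.normSq_apply, Complex.normSq_apply]
  simp
  nlinarith

theorem norm_one_sub_mul_bounds (z : ℂ) (t : I) :
    ‖z - 2‖ - ‖z‖ ≤ 2 * ‖1 - z * ((t : ℝ) : ℂ)‖ ∧
      2 * ‖1 - z * ((t : ℝ) : ℂ)‖ ≤ ‖z - 2‖ + ‖z‖ := by
  have e : (2 - z) + ((1 - 2 * t : ℝ) : ℂ) * z = 2 * (1 - z * ((t : ℝ) : ℂ)) := by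
    push_cast; ring
  have h2 : 2 * ‖1 - z * ((t : ℝ) : ℂ)‖ = ‖(2 - z) + ((1 - 2 * t : ℝ) : ℂ) * z‖ := by
    rw [e, norm_mul]; simp
  have h3 : ‖((1 - 2 * t : ℝ) : ℂ) * z‖ ≤ ‖z‖ := by
    rw [norm_mul, Complex.norm_real, Real.norm_eq_abs]
    refine mul_le_of_le_one_left (norm_nonneg _) (abs_le.2 ⟨?_, ?_⟩) <;>
      linarith [t.2.1, t.2.2]
  rw [h2, norm_sub_rev z 2]
  constructor
  · have := norm_sub_le_norm_add (2 - z) (((1 - 2 * t : ℝ) : ℂ) * z)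
    linarith
  · have := norm_add_le (2 - z) (((1 - 2 * t : ℝ) : ℂ) * z)
    linarith

/-- `h` and `2 h ^ 2 - 1` are the cosines of half the angle and of the angle between `1` and
`1 - z`. -/
theorem bisector_cos_bounds {z : ℂ} (hz : z.re < 1) {h : ℝ} (h0 : 0 ≤ h)
    (hh : 2 * h ^ 2 - 1 = (1 - z).re / ‖1 - z‖) :
    ‖z - 2‖ ≤ h * (‖z - 2‖ + ‖z‖) ∧
      ‖z - 2‖ ^ 2 - ‖z‖ ^ 2 ≤ (2 * h ^ 2 - 1) * (‖z - 2‖ ^ 2 + ‖z‖ ^ 2) := by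
  have hx : 0 < (1 - z).re := by simpa using hz
  have hρ : 0 < ‖1 - z‖ := hx.trans_le (Complex.re_le_norm _)
  have sq_eq (w : ℂ) : ‖w‖ ^ 2 = w.re ^ 2 + w.im ^ 2 := by
    rw [← Complex.normSq_eq_norm_sq, Complex.normSq_apply]; ring
  have hρ2 := sq_eq (1 - z)
  have hsub : ‖z - 2‖ ^ 2 - ‖z‖ ^ 2 = 4 * (1 - z).re := by
    rw [sq_eq, sq_eq]; simp; ring
  have hadd : ‖z - 2‖ ^ 2 + ‖z‖ ^ 2 = 2 + 2 * ‖1 - z‖ ^ 2 := by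
    rw [sq_eq, sq_eq, sq_eq]; simp; ring
  have hcos : ‖z - 2‖ ^ 2 - ‖z‖ ^ 2 ≤ (2 * h ^ 2 - 1) * (‖z - 2‖ ^ 2 + ‖z‖ ^ 2) := by
    rw [hsub, hadd, hh, div_mul_eq_mul_div, le_div_iff₀ hρ]
    nlinarith [mul_nonneg hx.le (sq_nonneg (‖1 - z‖ - 1))]
  refine ⟨?_, hcos⟩
  rw [← sq_le_sq₀ (norm_nonneg _) (by positivity), mul_pow]
  have h1 : ‖z - 2‖ ^ 2 ≤ h ^ 2 * (‖z - 2‖ ^ 2 + ‖z‖ ^ 2) := by linarith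
  refine h1.trans (mul_le_mul_of_nonneg_left ?_ (sq_nonneg h))
  nlinarith [mul_nonneg (norm_nonneg (z - 2)) (norm_nonneg z)]

/-- The estimates for `J₁ = ∫ t / (1 - z t) dν` and `J₂ = ∫ t / (1 - z t) ^ 2 dν`, through the integrals
`M₁`, `M₂` of the moduli of their integrands. Comparing `J` with `M` costs a factor from the
opening of the sector containing the `1 - z t`; comparing `M₂`, `M₁` and `∫ t dν` with each other
costs the bounds for `‖1 - z t‖`. -/
theorem exists_stieltjes_estimates (ν : Measure I) [IsFiniteMeasure ν] {z : ℂ} (hz : z.re < 1)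
    {J₁ J₂ : ℂ} {S : ℝ}
    (hJ₁ : J₁ = ∫ t : I, ((t : ℝ) : ℂ) * (1 - z * ((t : ℝ) : ℂ))⁻¹ ∂ν)
    (hJ₂ : J₂ = ∫ t : I, ((t : ℝ) : ℂ) * (1 - z * ((t : ℝ) : ℂ))⁻¹ ^ 2 ∂ν)
    (hS : S = ∫ t : I, (t : ℝ) ∂ν) :
    ∃ M₁ M₂ : ℝ,
      ‖z - 2‖ * M₁ ≤ (‖z - 2‖ + ‖z‖) * ‖J₁‖ ∧ ‖J₁‖ ≤ M₁ ∧
      (‖z - 2‖ ^ 2 - ‖z‖ ^ 2) * M₂ ≤ (‖z - 2‖ ^ 2 + ‖z‖ ^ 2) * ‖J₂‖ ∧ ‖J₂‖ ≤ M₂ ∧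
      2 * S ≤ (‖z - 2‖ + ‖z‖) * M₁ ∧ (‖z - 2‖ - ‖z‖) * M₁ ≤ 2 * S ∧
      2 * M₁ ≤ (‖z - 2‖ + ‖z‖) * M₂ ∧ (‖z - 2‖ - ‖z‖) * M₂ ≤ 2 * M₁ := by
  have hs (t : I) : 1 - z * ((t : ℝ) : ℂ) ≠ 0 :=
    one_sub_mul_ne_zero_of_mem_cutPlane (mem_cutPlane_of_re_lt_one hz) t
  have hsn (t : I) : 0 < ‖1 - z * ((t : ℝ) : ℂ)‖ := norm_pos_iff.2 (hs t)
  have hb := norm_one_sub_mul_bounds z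
  have hinv : Continuous fun t : I => (1 - z * ((t : ℝ) : ℂ))⁻¹ :=
    Continuous.inv₀ (by fun_prop) hs
  have hf₁ : Continuous fun t : I => ((t : ℝ) : ℂ) * (1 - z * ((t : ℝ) : ℂ))⁻¹ := by fun_prop
  have hf₂ : Continuous fun t : I => ((t : ℝ) : ℂ) * (1 - z * ((t : ℝ) : ℂ))⁻¹ ^ 2 := by fun_prop
  have hn₁ (t : I) : ‖((t : ℝ) : ℂ) * (1 - z * ((t : ℝ) : ℂ))⁻¹‖ =
      t * ‖(1 - z * ((t : ℝ) : ℂ))⁻¹‖ := by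
    rw [norm_mul, Complex.norm_real, Real.norm_of_nonneg t.2.1]
  have hn₂ (t : I) : ‖((t : ℝ) : ℂ) * (1 - z * ((t : ℝ) : ℂ))⁻¹ ^ 2‖ =
      t * ‖(1 - z * ((t : ℝ) : ℂ))⁻¹ ^ 2‖ := by
    rw [norm_mul, Complex.norm_real, Real.norm_of_nonneg t.2.1]
  obtain ⟨u, hu, h, h0, hh, hsec⟩ := exists_bisector (q := 1 - z) (by simpa using hz)
  have hsec' (t : I) := mul_norm_inv_le_re (u := u) (s := 1 - z * ((t : ℝ) : ℂ)) (h := h) (by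
    convert hsec t t.2 using 2
    · congr 1; ring
    · congr 1; ring)
  have hu' : ‖(starRingEnd ℂ) u‖ = 1 := by rw [RCLike.norm_conj, hu]
  obtain ⟨hcos₁, hcos₂⟩ := bisector_cos_bounds hz h0 hh
  have hi {g : I → ℝ} (hg : Continuous g) : Integrable g ν :=
    integrable_unitInterval_of_continuous ν hg
  refine ⟨∫ t : I, ‖((t : ℝ) : ℂ) * (1 - z * ((t : ℝ) : ℂ))⁻¹‖ ∂ν,
    ∫ t : I, ‖((t : ℝ) : ℂ) * (1 - z * ((t : ℝ) : ℂ))⁻¹ ^ 2‖ ∂ν, ?_, ?_, ?_, ?_, ?_, ?_, ?_, ?_⟩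
  · have hJ := mul_integral_norm_le_norm_integral ν hf₁ hu' (c := h) fun t => by
      rw [hn₁, mul_left_comm, mul_left_comm _ ((t : ℝ) : ℂ), Complex.re_ofReal_mul]
      exact mul_le_mul_of_nonneg_left (hsec' t) t.2.1
    rw [← hJ₁] at hJ
    have hM : 0 ≤ ∫ t : I, ‖((t : ℝ) : ℂ) * (1 - z * ((t : ℝ) : ℂ))⁻¹‖ ∂ν :=
      integral_nonneg fun _ => norm_nonneg _
    have hl := mul_le_mul_of_nonneg_right hcos₁ hM
    have hr := mul_le_mul_of_nonneg_left hJ (by positivity : 0 ≤ ‖z - 2‖ + ‖z‖)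
    linarith
  · rw [hJ₁]
    exact norm_integral_le_integral_norm _
  · have hJ := mul_integral_norm_le_norm_integral ν hf₂ (u := (starRingEnd ℂ) u ^ 2)
      (by rw [norm_pow, hu', one_pow]) (c := 2 * h ^ 2 - 1) fun t => by
        rw [hn₂, mul_left_comm, mul_left_comm _ ((t : ℝ) : ℂ), Complex.re_ofReal_mul]
        exact mul_le_mul_of_nonneg_left (mul_norm_sq_le_re_sq hu' h0 (hsec' t)) t.2.1
    rw [← hJ₂] at hJ
    have hM : 0 ≤ ∫ t : I, ‖((t : ℝ) : ℂ) * (1 - z * ((t : ℝ) : ℂ))⁻¹ ^ 2‖ ∂ν :=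
      integral_nonneg fun _ => norm_nonneg _
    have hl := mul_le_mul_of_nonneg_right hcos₂ hM
    have hr := mul_le_mul_of_nonneg_left hJ (by positivity : 0 ≤ ‖z - 2‖ ^ 2 + ‖z‖ ^ 2)
    linarith
  · rw [hJ₂]
    exact norm_integral_le_integral_norm _
  · rw [hS, ← integral_const_mul, ← integral_const_mul]
    refine integral_mono (hi (by fun_prop)) (hi (by fun_prop)) fun t => ?_
    simp only [hn₁, norm_inv]
    have := mul_le_mul_of_nonneg_left (hb t).2 (div_nonneg t.2.1 (hsn t).le)
    calc 2 * (t : ℝ) = t / ‖1 - z * ((t : ℝ) : ℂ)‖ * (2 * ‖1 - z * ((t : ℝ) : ℂ)‖) := by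
          have := (hsn t).ne'
          field_simp
      _ ≤ _ := this
      _ = _ := by ring
  · rw [hS, ← integral_const_mul, ← integral_const_mul]
    refine integral_mono (hi (by fun_prop)) (hi (by fun_prop)) fun t => ?_
    simp only [hn₁, norm_inv]
    have := mul_le_mul_of_nonneg_left (hb t).1 (div_nonneg t.2.1 (hsn t).le)
    calc _ = t / ‖1 - z * ((t : ℝ) : ℂ)‖ * (‖z - 2‖ - ‖z‖) := by ring
      _ ≤ _ := this
      _ = _ := by
          have := (hsn t).ne'
          field_simp
  · rw [← integral_const_mul, ← integral_const_mul]
    refine integral_mono (hi (by fun_prop)) (hi (by fun_prop)) fun t => ?_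
    simp only [hn₁, hn₂, norm_inv, norm_pow]
    have := mul_le_mul_of_nonneg_left (hb t).2
      (div_nonneg t.2.1 (sq_nonneg ‖1 - z * ((t : ℝ) : ℂ)‖))
    calc _ = t / ‖1 - z * ((t : ℝ) : ℂ)‖ ^ 2 * (2 * ‖1 - z * ((t : ℝ) : ℂ)‖) := by
          have := (hsn t).ne'
          field_simp
      _ ≤ _ := this
      _ = _ := by ring
  · rw [← integral_const_mul, ← integral_const_mul]
    refine integral_mono (hi (by fun_prop)) (hi (by fun_prop)) fun t => ?_
    simp only [hn₁, hn₂, norm_inv, norm_pow]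
    have := mul_le_mul_of_nonneg_left (hb t).1
      (div_nonneg t.2.1 (sq_nonneg ‖1 - z * ((t : ℝ) : ℂ)‖))
    calc _ = t / ‖1 - z * ((t : ℝ) : ℂ)‖ ^ 2 * (‖z - 2‖ - ‖z‖) := by ring
      _ ≤ _ := this
      _ = _ := by
          have := (hsn t).ne'
          field_simp

/-- The growth and distortion bounds of a univalent function, for the function `w ↦ z J₁` of the
disc variable `w = z / (2 - z)`, with denominators cleared. -/
theorem stieltjes_distortion (ν : Measure I) [IsFiniteMeasure ν] {z : ℂ} (hz : z.re < 1)
    {J₁ J₂ : ℂ} {S : ℝ}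
    (hJ₁ : J₁ = ∫ t : I, ((t : ℝ) : ℂ) * (1 - z * ((t : ℝ) : ℂ))⁻¹ ∂ν)
    (hJ₂ : J₂ = ∫ t : I, ((t : ℝ) : ℂ) * (1 - z * ((t : ℝ) : ℂ))⁻¹ ^ 2 ∂ν)
    (hS : S = ∫ t : I, (t : ℝ) ∂ν) :
    (2 * S * ‖z - 2‖ ≤ (‖z - 2‖ + ‖z‖) ^ 2 * ‖J₁‖ ∧
      (‖z - 2‖ - ‖z‖) ^ 2 * ‖J₁‖ ≤ 2 * S * ‖z - 2‖) ∧
    (4 * S * (‖z - 2‖ - ‖z‖) ≤ (‖z - 2‖ + ‖z‖) ^ 3 * ‖J₂‖ ∧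
      (‖z - 2‖ - ‖z‖) ^ 3 * ‖J₂‖ ≤ 4 * S * (‖z - 2‖ + ‖z‖)) ∧
    (2 * (‖z - 2‖ - ‖z‖) * ‖J₁‖ ≤ ‖z - 2‖ * (‖z - 2‖ + ‖z‖) * ‖J₂‖ ∧
      ‖z - 2‖ * (‖z - 2‖ - ‖z‖) * ‖J₂‖ ≤ 2 * (‖z - 2‖ + ‖z‖) * ‖J₁‖) := by
  obtain ⟨M₁, M₂, h1, h2, h3, h4, h5, h6, h7, h8⟩ := exists_stieltjes_estimates ν hz hJ₁ hJ₂ hS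
  have hS0 : 0 ≤ S := hS ▸ integral_nonneg fun t => t.2.1
  have hlt := norm_lt_norm_sub_two hz
  have hR := norm_nonneg z
  have hj₁ := norm_nonneg J₁
  have hj₂ := norm_nonneg J₂
  generalize ‖z - 2‖ = D at *
  generalize ‖z‖ = R at *
  generalize ‖J₁‖ = j₁ at *
  generalize ‖J₂‖ = j₂ at *
  have hD : 0 < D := by linarith
  have hd : 0 < D - R := by linarith
  have hs : 0 < D + R := by linarith
  -- `D ^ 2 + R ^ 2` is at most `D * (D + R)` and at most `(D + R) ^ 2`; the ratio bound needs the
  -- first estimate, the distortion bound only the second.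
  have h3D : (D - R) * (D + R) * M₂ ≤ D * (D + R) * j₂ := by
    nlinarith [mul_nonneg (mul_nonneg hR hd.le) hj₂]
  have h3s : (D - R) * M₂ ≤ (D + R) * j₂ := by
    refine le_of_mul_le_mul_left ?_ hs
    nlinarith [mul_nonneg (mul_nonneg hR hs.le) hj₂]
  refine ⟨⟨?_, ?_⟩, ⟨?_, ?_⟩, ?_, ?_⟩
  · calc 2 * S * D ≤ (D + R) * M₁ * D := by gcongr
      _ = (D + R) * (D * M₁) := by ring
      _ ≤ (D + R) * ((D + R) * j₁) := by gcongr
      _ = _ := by ring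
  · calc (D - R) ^ 2 * j₁ ≤ (D - R) ^ 2 * M₁ := by gcongr
      _ = (D - R) * ((D - R) * M₁) := by ring
      _ ≤ (D - R) * (2 * S) := by gcongr
      _ ≤ D * (2 * S) := by gcongr; linarith
      _ = _ := by ring
  · calc 4 * S * (D - R) = 2 * (D - R) * (2 * S) := by ring
      _ ≤ 2 * (D - R) * ((D + R) * M₁) := by gcongr
      _ = (D - R) * (D + R) * (2 * M₁) := by ring
      _ ≤ (D - R) * (D + R) * ((D + R) * M₂) := by gcongr
      _ = (D + R) ^ 2 * ((D - R) * M₂) := by ring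
      _ ≤ (D + R) ^ 2 * ((D + R) * j₂) := by gcongr
      _ = _ := by ring
  · calc (D - R) ^ 3 * j₂ ≤ (D - R) ^ 3 * M₂ := by gcongr
      _ = (D - R) ^ 2 * ((D - R) * M₂) := by ring
      _ ≤ (D - R) ^ 2 * (2 * M₁) := by gcongr
      _ = 2 * (D - R) * ((D - R) * M₁) := by ring
      _ ≤ 2 * (D - R) * (2 * S) := by gcongr
      _ = 4 * S * (D - R) := by ring
      _ ≤ _ := by gcongr; linarith
  · calc 2 * (D - R) * j₁ ≤ 2 * (D - R) * M₁ := by gcongr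
      _ = (D - R) * (2 * M₁) := by ring
      _ ≤ (D - R) * ((D + R) * M₂) := by gcongr
      _ = (D - R) * (D + R) * M₂ := by ring
      _ ≤ _ := h3D
  · calc D * (D - R) * j₂ ≤ D * (D - R) * M₂ := by gcongr
      _ = D * ((D - R) * M₂) := by ring
      _ ≤ D * (2 * M₁) := by gcongr
      _ = 2 * (D * M₁) := by ring
      _ ≤ 2 * ((D + R) * j₁) := by gcongr
      _ = _ := by ring

/-! ### Growth and distortion of the hypergeometric function -/

theorem mainTheorem2 (p : ℕ) (a : Fin (p + 1) → ℝ) (b : Fin p → ℝ)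
    (ha : ∀ i, 0 < a i) (hb : ∀ j, 0 < b j) (ha1 : a 0 ≤ 1)
    (hv : ∀ t ∈ Set.Icc (0 : ℝ) 1, 0 ≤ muntzPolynomial (Fin.tail a) b t)
    (A B : ℝ) (hA : A = ∏ i, a i) (hB : B = ∏ j, b j)
    (F G : ℂ → ℂ)
    (hF : F = genHypergeometric (fun i => (a i : ℂ)) (fun j => (b j : ℂ)))
    (hG : G = genHypergeometric (fun i => (a i : ℂ) + 1) (fun j => (b j : ℂ) + 1))
    (z : ℂ) (hz : z.re < 1) :
    (2 * A * ‖z - 2‖ * ‖z‖ / (B * (‖z - 2‖ + ‖z‖) ^ 2) ≤ ‖F z - 1‖ ∧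
      ‖F z - 1‖ ≤ 2 * A * ‖z - 2‖ * ‖z‖ / (B * (‖z - 2‖ - ‖z‖) ^ 2)) ∧
    (4 * (‖z - 2‖ - ‖z‖) / (‖z - 2‖ + ‖z‖) ^ 3 ≤ ‖G z‖ ∧
      ‖G z‖ ≤ 4 * (‖z - 2‖ + ‖z‖) / (‖z - 2‖ - ‖z‖) ^ 3) ∧
    (z ≠ 0 →
      2 * B * (‖z - 2‖ - ‖z‖) / (A * ‖z‖ * ‖z - 2‖ * (‖z - 2‖ + ‖z‖)) ≤ ‖G z / (F z - 1)‖ ∧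
      ‖G z / (F z - 1)‖ ≤
        2 * B * (‖z - 2‖ + ‖z‖) / (A * ‖z‖ * ‖z - 2‖ * (‖z - 2‖ - ‖z‖))) := by
  obtain ⟨ν, hν⟩ := exists_hypergeometric_measure ha hb ha1 hv
  have hzc := mem_cutPlane_of_re_lt_one hz
  have hA0 : 0 < A := hA ▸ Finset.prod_pos fun i _ => ha i
  have hB0 : 0 < B := hB ▸ Finset.prod_pos fun j _ => hb j
  have hAB : (∏ j, (b j : ℂ)) / (∏ i, (a i : ℂ)) = ((B / A : ℝ) : ℂ) := by
    rw [hA, hB]; push_cast; rfl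
  -- `J₁ = (F z - 1) / z`, and `J₂` is the derivative of `F` at `z`.
  set J₁ := ∫ t : I, ((t : ℝ) : ℂ) * (1 - z * ((t : ℝ) : ℂ))⁻¹ ∂(ν : Measure I) with hJ₁
  set J₂ := ∫ t : I, ((t : ℝ) : ℂ) * (1 - z * ((t : ℝ) : ℂ))⁻¹ ^ 2 ∂(ν : Measure I) with hJ₂
  have hs (t : I) : 1 - z * ((t : ℝ) : ℂ) ≠ 0 := one_sub_mul_ne_zero_of_mem_cutPlane hzc t
  have hFz : F z - 1 = z * J₁ := by
    rw [hF, genHypergeometric_eq_stieltjesIntegral ν 0 1 (fun n => by simp [← hν]) hzc, one_mul,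
      stieltjesIntegral, hJ₁, ← integral_const_mul]
    trans ∫ t : I, (((t : ℝ) : ℂ) ^ 0 / (1 - z * ((t : ℝ) : ℂ)) ^ (0 + 1) - 1) ∂(ν : Measure I)
    · rw [integral_sub (integrable_unitInterval_of_continuous _
        (continuous_stieltjes_kernel hzc 0)) (integrable_const _)]
      simp
    refine integral_congr_ae (ae_of_all _ fun t => ?_)
    have := hs t
    simp only
    field_simp
    ring
  have hGz : G z = ((B / A : ℝ) : ℂ) * J₂ := by
    rw [hG, genHypergeometric_eq_stieltjesIntegral ν 1 ((B / A : ℝ) : ℂ) (fun n => by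
      rw [hypergeometric_coeff_add_one ha hb, hAB, hν]; simp) hzc, stieltjesIntegral]
    congr 1
    refine integral_congr_ae (ae_of_all _ fun t => ?_)
    simp [div_eq_mul_inv]
  -- The first moment of `ν` is the linear coefficient of the series of `F`.
  have hS : A / B = ∫ t : I, (t : ℝ) ∂(ν : Measure I) := by
    have h := hν 1
    rw [vecPochhammer, vecPochhammer] at h
    simp only [ascPochhammer_one, Polynomial.eval_X, pow_one, Nat.factorial_one, Nat.cast_one,
      mul_one] at h
    rw [hA, hB]
    exact_mod_cast h.symm
  obtain ⟨⟨h1, h2⟩, ⟨h3, h4⟩, h5, h6⟩ := stieltjes_distortion (ν : Measure I) hz hJ₁ hJ₂ hS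
  have hFn : ‖F z - 1‖ = ‖z‖ * ‖J₁‖ := by rw [hFz, norm_mul]
  have hGn : ‖G z‖ = B / A * ‖J₂‖ := by
    rw [hGz, norm_mul, Complex.norm_real, Real.norm_of_nonneg (by positivity)]
  have hlt := norm_lt_norm_sub_two hz
  have hd : 0 < ‖z - 2‖ - ‖z‖ := by linarith
  have hD : 0 < ‖z - 2‖ := (norm_nonneg z).trans_lt hlt
  have hs0 : 0 < ‖z - 2‖ + ‖z‖ := by positivity
  have hS0 : 0 < A / B := by positivity
  have hj₁ : 0 < ‖J₁‖ :=
    pos_of_mul_pos_right ((by positivity : 0 < 2 * (A / B) * ‖z - 2‖).trans_le h1) (by positivity)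
  rw [norm_div, hFn, hGn]
  refine ⟨⟨?_, ?_⟩, ⟨?_, ?_⟩, fun hz0 => ?_⟩
  · calc _ = 2 * (A / B) * ‖z - 2‖ * ‖z‖ / (‖z - 2‖ + ‖z‖) ^ 2 := by field_simp
      _ ≤ _ := by
        rw [div_le_iff₀ (by positivity)]
        linarith [mul_le_mul_of_nonneg_left h1 (norm_nonneg z)]
  · calc _ ≤ 2 * (A / B) * ‖z - 2‖ * ‖z‖ / (‖z - 2‖ - ‖z‖) ^ 2 := by
          rw [le_div_iff₀ (by positivity)]
          linarith [mul_le_mul_of_nonneg_left h2 (norm_nonneg z)]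
      _ = _ := by field_simp
  · rw [div_le_iff₀ (by positivity)]
    have := mul_le_mul_of_nonneg_left h3 (by positivity : 0 ≤ B / A)
    calc _ = B / A * (4 * (A / B) * (‖z - 2‖ - ‖z‖)) := by field_simp
      _ ≤ _ := this
      _ = _ := by ring
  · rw [le_div_iff₀ (by positivity)]
    have := mul_le_mul_of_nonneg_left h4 (by positivity : 0 ≤ B / A)
    calc _ = B / A * ((‖z - 2‖ - ‖z‖) ^ 3 * ‖J₂‖) := by ring
      _ ≤ _ := this
      _ = _ := by field_simp
  · have hz' : 0 < ‖z‖ := norm_pos_iff.2 hz0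
    have e : B / A * ‖J₂‖ / (‖z‖ * ‖J₁‖) = B / (A * ‖z‖) * (‖J₂‖ / ‖J₁‖) := by field_simp
    rw [e]
    constructor
    · calc _ = B / (A * ‖z‖) * (2 * (‖z - 2‖ - ‖z‖) / (‖z - 2‖ * (‖z - 2‖ + ‖z‖))) := by
            field_simp
        _ ≤ _ := by
            refine mul_le_mul_of_nonneg_left ?_ (by positivity)
            rw [div_le_div_iff₀ (by positivity) hj₁]
            linarith
    · calc _ ≤ B / (A * ‖z‖) * (2 * (‖z - 2‖ + ‖z‖) / (‖z - 2‖ * (‖z - 2‖ - ‖z‖))) := by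
            refine mul_le_mul_of_nonneg_left ?_ (by positivity)
            rw [div_le_div_iff₀ hj₁ (by positivity)]
            linarith
        _ = _ := by field_simp
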